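/- For a modulus $0\le k<1$ let $$F(\varphi,k)=\int_0^\varphi\frac{d\theta}{\sqrt{1-k^2\sin^2\theta}},\quad E(\varphi,k)=\int_0^\varphi\sqrt{1-k^2\sin^2\theta}\,d\theta,\quad \Pi(\varphi,n,k)=\int_0^\varphi\frac{d\theta}{(1-n\sin^2\theta)\sqrt{1-k^2\sin^2\theta}},$$ let $\operatorname{am}(\cdot,k)$ be the inverse function of $F(\cdot,k)$, and let $\operatorname{sn}=\sin\operatorname{am}$, $\operatorname{cn}=\cos\operatorname{am}$, $\operatorname{dn}=\sqrt{1-k^2\operatorname{sn}^2}$. Let $H\neq 0$, $\mu>0$ and $1<b<1/\mu$ be real numbers. Put $c_1=\sqrt{(1-\mu^2b^2)(b^2-1)}$ and $g(u)=\frac{c_1}{b}\,\Pi(\operatorname{am}(u,\mu),\mu^2b^2,\mu)$. The cmc-$H$ helicoid with parameters $(\mu,b)$ is the surface $\mathbf x:\mathbb R^2\to\mathbb E^3=\mathbb C\times\mathbb R$ defined by $$-2H\,\mathbf x(u,v)=\begin{pmatrix} e^{iv/b}\,e^{ig(u)}\left(\sqrt{1-\mu^2b^2\operatorname{sn}^2}+\dfrac{\mu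 b\,(b\operatorname{cn}\operatorname{dn}-i c_1\operatorname{sn})}{\sqrt{1-\mu^2b^2\operatorname{sn}^2}}\right)\\[3mm] -\mu b\operatorname{sn}+\left(b-\tfrac1b\right)u-b\,E(\operatorname{am}(u,\mu),\mu)+\dfrac{c_1v}{b}\end{pmatrix},$$ where $\operatorname{sn},\operatorname{cn},\operatorname{dn}$ are evaluated at $(u,\mu)$. Its cgc-companion is the parallel surface $\check{\mathbf x}=\mathbf x+\frac1{2H}\mathbf n$, where $\mathbf n=(\mathbf x_u\times\mathbf x_v)/|\mathbf x_u\times\mathbf x_v|$ is the Gauss map of $\mathbf x$. A surface $\mathbf y:\mathbb R^2\to\mathbb E^3$ is called periodic (a helicoidal cylinder) if there is $(p,h)\in\mathbb R^2\setminus\{(0,0)\}$ with $\mathbf y(u+p,v+h)=\mathbf y(u,v)$ for all $(u,v)\in\mathbb R^2$. Let $$\Phi(\mu,b)=\frac{c_1^2\,\Pi+b^2E+(1-b^2)K}{\pi\,b\,c_1},$$ where $K=F(\tfrac\pi2,\mu)$, $E=E(\tfrac\pi2,\mu)$, $\Pi=\Pi(\tfrac\pi2,\mu^2b^2,\mu)$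 are the complete elliptic integrals. Then the cgc-companion $\check{\mathbf x}$ is periodic if and only if $\Phi(\mu,b)\in\mathbb Q$, and the cmc-$H$ helicoid $\mathbf x$ itself is periodic if and only if $\Phi(\mu,b)\in\mathbb Q$. -/

import Mathlib

noncomputable section

namespace CmcHelicoid

/-! ### Elliptic integrals and Jacobi elliptic functions (modulus `k`) -/

/-- Incomplete elliptic integral of the first kind `F(φ, k)`. -/
def ellipticF (φ k : ℝ) : ℝ :=
  ∫ θ in (0 : ℝ)..φ, 1 / Real.sqrt (1 - k ^ 2 * Real.sin θ ^ 2)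

/-- Incomplete elliptic integral of the second kind `E(φ, k)`. -/
def ellipticE (φ k : ℝ) : ℝ :=
  ∫ θ in (0 : ℝ)..φ, Real.sqrt (1 - k ^ 2 * Real.sin θ ^ 2)

/-- Incomplete elliptic integral of the third kind `Π(φ, n, k)`, with characteristic `n`. -/
def ellipticPi (φ n k : ℝ) : ℝ :=
  ∫ θ in (0 : ℝ)..φ, 1 / ((1 - n * Real.sin θ ^ 2) * Real.sqrt (1 - k ^ 2 * Real.sin θ ^ 2))

/-- Complete elliptic integral of the first kind `K(k)`. -/
def completeK (k : ℝ) : ℝ := ellipticF (Real.pi / 2) k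

/-- Complete elliptic integral of the second kind `E(k)`. -/
def completeE (k : ℝ) : ℝ := ellipticE (Real.pi / 2) k

/-- Complete elliptic integral of the third kind `Π(n, k)`. -/
def completePi (n k : ℝ) : ℝ := ellipticPi (Real.pi / 2) n k

/-- Jacobi amplitude `am(u, k)`: the inverse function of `φ ↦ F(φ, k)`, which is a
bijection of `ℝ` for `0 ≤ k < 1`, the only moduli used. -/
def am (u k : ℝ) : ℝ := Function.invFun (fun φ : ℝ => ellipticF φ k) u

/-- Jacobi's `sn(u, k)`. -/
def sn (u k : ℝ) : ℝ := Real.sin (am u k)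

/-- Jacobi's `cn(u, k)`. -/
def cn (u k : ℝ) : ℝ := Real.cos (am u k)

/-- Jacobi's `dn(u, k)`. -/
def dn (u k : ℝ) : ℝ := Real.sqrt (1 - k ^ 2 * sn u k ^ 2)

/-! ### Parametrized surfaces in Euclidean 3-space -/

/-- Euclidean 3-space. -/
abbrev E3 : Type := EuclideanSpace ℝ (Fin 3)

/-- The identification `ℂ × ℝ = E3`. -/
def ofCR (X : ℂ) (z : ℝ) : E3 := !₂[X.re, X.im, z]

/-- The vector product `x_u × x_v` of the coordinate tangent vectors of a surface
`x = x(u, v)`. -/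
def normalVector (x : ℝ × ℝ → E3) (p : ℝ × ℝ) : E3 :=
  WithLp.toLp 2 (crossProduct
    (WithLp.ofLp (deriv (fun s : ℝ => x (s, p.2)) p.1))
    (WithLp.ofLp (deriv (fun t : ℝ => x (p.1, t)) p.2)))

/-- The Gauss map `(x_u × x_v) / |x_u × x_v|`. -/
def gaussMap (x : ℝ × ℝ → E3) (p : ℝ × ℝ) : E3 :=
  ‖normalVector x p‖⁻¹ • normalVector x p

/-- The cgc-companion of a cmc-`H` surface `x`: the parallel surface `x + (1 / 2H) n`, where
`n` is the Gauss map. -/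
def cgcCompanion (H : ℝ) (x : ℝ × ℝ → E3) (p : ℝ × ℝ) : E3 :=
  x p + (1 / (2 * H)) • gaussMap x p

/-- A parametrized surface has a period if it is invariant under a nonzero translation of the
parameter plane, i.e. it descends to a map from the cylinder `ℝ² / ℤc ≅ S¹ × ℝ`. -/
def HasPeriod (x : ℝ × ℝ → E3) : Prop :=
  ∃ c : ℝ × ℝ, c ≠ 0 ∧ Function.Periodic x c

/-! ### The cmc-`H` helicoid with parameters `(μ, b)` -/

/-- `c₁ = √((1 - μ²b²)(b² - 1))`. -/
def c₁ (μ b : ℝ) : ℝ := Real.sqrt ((1 - μ ^ 2 * b ^ 2) * (b ^ 2 - 1))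

/-- The angle function `g(u) = (c₁ / b) Π(am(u, μ), μ²b², μ)`. -/
def g (μ b u : ℝ) : ℝ := c₁ μ b / b * ellipticPi (am u μ) (μ ^ 2 * b ^ 2) μ

/-- The function `√(1 - μ²b² sn²(u, μ))`. -/
def rad (μ b u : ℝ) : ℝ := Real.sqrt (1 - μ ^ 2 * b ^ 2 * sn u μ ^ 2)

/-- The `ℂ`-component of the generating curve, before the rotation by `g`. -/
def profileC (μ b u : ℝ) : ℂ :=
  (rad μ b u : ℂ) +
    (μ : ℂ) * b * ((b : ℂ) * cn u μ * dn u μ - Complex.I * c₁ μ b * sn u μ) / (rad μ b u : ℂ)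

/-- The `ℝ`-component of the generating curve. -/
def profileR (μ b u : ℝ) : ℝ :=
  -(μ * b * sn u μ) + ((b - 1 / b) * u - b * ellipticE (am u μ) μ)

/-- The cmc-`H` helicoid `x` with parameters `(μ, b)`:
`-2H x(u, v)` is the vector
`(e^{iv/b} e^{ig(u)} profileC(u), profileR(u) + c₁ v / b)` of `ℂ × ℝ`. -/
def cmcHelicoid (H μ b : ℝ) (p : ℝ × ℝ) : E3 :=
  (-(1 / (2 * H))) •
    ofCR (Complex.exp (Complex.I * ((p.2 / b : ℝ) : ℂ)) *
        Complex.exp (Complex.I * (g μ b p.1 : ℂ)) * profileC μ b p.1)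
      (profileR μ b p.1 + c₁ μ b * p.2 / b)

/-- `Φ(μ, b) = (c₁² Π + b² E + (1 - b²) K) / (π b c₁)`, where `K = K(μ)`, `E = E(μ)` and
`Π = Π(μ²b², μ)` are complete elliptic integrals. -/
def Φ (μ b : ℝ) : ℝ :=
  (c₁ μ b ^ 2 * completePi (μ ^ 2 * b ^ 2) μ + b ^ 2 * completeE μ
      + (1 - b ^ 2) * completeK μ) /
    (Real.pi * b * c₁ μ b)

end CmcHelicoid

end

noncomputable section

namespace CmcHelicoid

open intervalIntegral

/-! ### Integrals of even `π`-periodic functions -/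

/-! The Gauss map of `cmcHelicoid` is the rotated vector `(rad, -μ b sn)` (`gaussMap_cmcHelicoid`).
Adding it cancels `rad` and the `sn` term, so both surfaces have the form `screwSurface` with the
same angle and the same secular height, differing only in `C` and `T`.

Shifting `u` by `2 j K` adds fixed multiples of `Π` to the angle and of `K` and `E` to the height.
Choosing the shift of `v` that restores the height leaves a net rotation by `2 j π Φ` (`angle_eq`).
If `Φ` is rational, some even `j ≠ 0` makes this a multiple of `2π` while `C` and `T` return to
their values (`hasPeriod_of_phi_rational`).

Conversely, a period moves the origin to a parameter where `‖C‖` takes its value at `0`. This value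
is a maximum, attained only where `sn = 0` (`norm_profileC_sq_eq`, `norm_companion_sq`). So the
period is some `2 j K` in `u`, and the rotation by `2 j π Φ` sends `C 0` to `± C 0`, which makes `Φ`
rational (`phi_rational_of_hasPeriod`). -/

lemma integral_zero_pi_of_even_periodic {f : ℝ → ℝ} (hf : Continuous f)
    (heven : ∀ x, f (-x) = f x) (hper : Function.Periodic f Real.pi) :
    ∫ θ in (0 : ℝ)..Real.pi, f θ = 2 * ∫ θ in (0 : ℝ)..(Real.pi / 2), f θ := by
  have hi : ∀ a b : ℝ, IntervalIntegrable f MeasureTheory.volume a b :=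
    fun a b => hf.intervalIntegrable a b
  have h1 := hper.intervalIntegral_add_eq 0 (-(Real.pi / 2))
  rw [zero_add, show -(Real.pi / 2) + Real.pi = Real.pi / 2 by ring] at h1
  rw [h1, ← integral_add_adjacent_intervals (hi _ 0) (hi 0 _)]
  have h2 : ∫ θ in (-(Real.pi / 2))..0, f θ = ∫ θ in (0 : ℝ)..(Real.pi / 2), f θ := by
    have := integral_comp_neg (a := 0) (b := Real.pi / 2) f
    rw [neg_zero] at this
    rw [← this]
    simp only [heven]
  rw [h2]; ring

lemma integral_add_int_mul_pi {f : ℝ → ℝ} (hf : Continuous f)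
    (heven : ∀ x, f (-x) = f x) (hper : Function.Periodic f Real.pi) (φ : ℝ) (j : ℤ) :
    ∫ θ in (0 : ℝ)..(φ + j * Real.pi), f θ =
      (∫ θ in (0 : ℝ)..φ, f θ) + 2 * j * ∫ θ in (0 : ℝ)..(Real.pi / 2), f θ := by
  have hi : ∀ a b : ℝ, IntervalIntegrable f MeasureTheory.volume a b :=
    fun a b => hf.intervalIntegrable a b
  have h := hper.intervalIntegral_add_zsmul_eq j φ hi
  have h0 := hper.intervalIntegral_add_eq φ 0
  rw [zsmul_eq_mul, zsmul_eq_mul, h0, zero_add,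
    integral_zero_pi_of_even_periodic hf heven hper] at h
  rw [← integral_add_adjacent_intervals (hi 0 φ) (hi φ _), h]
  ring

/-! ### Elliptic integrals -/

lemma one_sub_sq_mul_sin_sq_pos {c : ℝ} (hc : 0 ≤ c) (hc1 : c < 1) (θ : ℝ) :
    0 < 1 - c * Real.sin θ ^ 2 := by
  nlinarith [Real.sin_sq_le_one θ, sq_nonneg (Real.sin θ)]

section Modulus

variable {k n : ℝ}

lemma continuous_integrandF (hk0 : 0 ≤ k) (hk1 : k < 1) :
    Continuous fun θ : ℝ => 1 / Real.sqrt (1 - k ^ 2 * Real.sin θ ^ 2) := by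
  refine continuous_const.div (by fun_prop) fun θ => ?_
  exact (Real.sqrt_pos.2 (one_sub_sq_mul_sin_sq_pos (sq_nonneg k) (by nlinarith) θ)).ne'

lemma continuous_integrandPi (hk0 : 0 ≤ k) (hk1 : k < 1) (hn0 : 0 ≤ n) (hn1 : n < 1) :
    Continuous fun θ : ℝ =>
      1 / ((1 - n * Real.sin θ ^ 2) * Real.sqrt (1 - k ^ 2 * Real.sin θ ^ 2)) := by
  refine continuous_const.div (by fun_prop) fun θ => ?_
  exact mul_ne_zero (one_sub_sq_mul_sin_sq_pos hn0 hn1 θ).ne'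
    (Real.sqrt_pos.2 (one_sub_sq_mul_sin_sq_pos (sq_nonneg k) (by nlinarith) θ)).ne'

lemma ellipticF_add_int_mul_pi (hk0 : 0 ≤ k) (hk1 : k < 1) (φ : ℝ) (j : ℤ) :
    ellipticF (φ + j * Real.pi) k = ellipticF φ k + 2 * j * completeK k :=
  integral_add_int_mul_pi (continuous_integrandF hk0 hk1) (fun x => by simp)
    (fun x => by simp [Real.sin_add_pi]) φ j

lemma ellipticE_add_int_mul_pi (φ : ℝ) (j : ℤ) :
    ellipticE (φ + j * Real.pi) k = ellipticE φ k + 2 * j * completeE k :=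
  integral_add_int_mul_pi (f := fun θ => Real.sqrt (1 - k ^ 2 * Real.sin θ ^ 2))
    (by fun_prop) (fun x => by simp)
    (fun x => by simp [Real.sin_add_pi]) φ j

lemma ellipticPi_add_int_mul_pi (hk0 : 0 ≤ k) (hk1 : k < 1) (hn0 : 0 ≤ n) (hn1 : n < 1)
    (φ : ℝ) (j : ℤ) :
    ellipticPi (φ + j * Real.pi) n k = ellipticPi φ n k + 2 * j * completePi n k :=
  integral_add_int_mul_pi (continuous_integrandPi hk0 hk1 hn0 hn1) (fun x => by simp)
    (fun x => by simp [Real.sin_add_pi]) φ j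

lemma hasDerivAt_ellipticF (hk0 : 0 ≤ k) (hk1 : k < 1) (φ : ℝ) :
    HasDerivAt (fun φ => ellipticF φ k) (1 / Real.sqrt (1 - k ^ 2 * Real.sin φ ^ 2)) φ :=
  (continuous_integrandF hk0 hk1).integral_hasStrictDerivAt 0 φ |>.hasDerivAt

lemma hasDerivAt_ellipticE (φ : ℝ) :
    HasDerivAt (fun φ => ellipticE φ k) (Real.sqrt (1 - k ^ 2 * Real.sin φ ^ 2)) φ :=
  (show Continuous fun θ : ℝ => Real.sqrt (1 - k ^ 2 * Real.sin θ ^ 2) by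
    fun_prop).integral_hasStrictDerivAt 0 φ |>.hasDerivAt

lemma hasDerivAt_ellipticPi (hk0 : 0 ≤ k) (hk1 : k < 1) (hn0 : 0 ≤ n) (hn1 : n < 1) (φ : ℝ) :
    HasDerivAt (fun φ => ellipticPi φ n k)
      (1 / ((1 - n * Real.sin φ ^ 2) * Real.sqrt (1 - k ^ 2 * Real.sin φ ^ 2))) φ :=
  (continuous_integrandPi hk0 hk1 hn0 hn1).integral_hasStrictDerivAt 0 φ |>.hasDerivAt

lemma continuous_ellipticF (hk0 : 0 ≤ k) (hk1 : k < 1) : Continuous fun φ => ellipticF φ k :=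
  continuous_iff_continuousAt.2 fun φ => (hasDerivAt_ellipticF hk0 hk1 φ).continuousAt

lemma strictMono_ellipticF (hk0 : 0 ≤ k) (hk1 : k < 1) : StrictMono fun φ => ellipticF φ k :=
  strictMono_of_deriv_pos fun φ => by
    rw [(hasDerivAt_ellipticF hk0 hk1 φ).deriv]
    exact one_div_pos.2
      (Real.sqrt_pos.2 (one_sub_sq_mul_sin_sq_pos (sq_nonneg k) (by nlinarith) φ))

@[simp] lemma ellipticF_zero : ellipticF 0 k = 0 := by simp [ellipticF]
@[simp] lemma ellipticE_zero : ellipticE 0 k = 0 := by simp [ellipticE]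
@[simp] lemma ellipticPi_zero : ellipticPi 0 n k = 0 := by simp [ellipticPi]

lemma completeK_pos (hk0 : 0 ≤ k) (hk1 : k < 1) : 0 < completeK k := by
  have := strictMono_ellipticF hk0 hk1 (show (0 : ℝ) < Real.pi / 2 by positivity)
  simpa [completeK] using this

/-- The values `± 2 N K` at `± N π` are unbounded in both directions; continuity fills in the rest.
-/
lemma surjective_ellipticF (hk0 : 0 ≤ k) (hk1 : k < 1) :
    Function.Surjective fun φ => ellipticF φ k := by
  intro u
  have hK := completeK_pos hk0 hk1
  obtain ⟨N, hN⟩ := exists_nat_ge (|u| / (2 * completeK k))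
  rw [div_le_iff₀ (by positivity)] at hN
  have h1 := ellipticF_add_int_mul_pi hk0 hk1 0 N
  have h2 := ellipticF_add_int_mul_pi hk0 hk1 0 (-N)
  simp only [ellipticF_zero, zero_add] at h1 h2
  push_cast at h1 h2
  refine mem_range_of_exists_le_of_exists_ge (continuous_ellipticF hk0 hk1)
    ⟨-N * Real.pi, ?_⟩ ⟨N * Real.pi, ?_⟩
  · rw [h2]; linarith [neg_abs_le u]
  · rw [h1]; linarith [le_abs_self u]

/-! ### The Jacobi amplitude and elliptic functions -/

lemma ellipticF_am (hk0 : 0 ≤ k) (hk1 : k < 1) (u : ℝ) : ellipticF (am u k) k = u :=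
  Function.rightInverse_invFun (surjective_ellipticF hk0 hk1) u

lemma am_ellipticF (hk0 : 0 ≤ k) (hk1 : k < 1) (φ : ℝ) : am (ellipticF φ k) k = φ :=
  Function.leftInverse_invFun (strictMono_ellipticF hk0 hk1).injective φ

lemma am_zero (hk0 : 0 ≤ k) (hk1 : k < 1) : am 0 k = 0 := by
  simpa using am_ellipticF hk0 hk1 0

lemma am_add (hk0 : 0 ≤ k) (hk1 : k < 1) (u : ℝ) (j : ℤ) :
    am (u + 2 * j * completeK k) k = am u k + j * Real.pi := by
  rw [← am_ellipticF hk0 hk1 (am u k + j * Real.pi), ellipticF_add_int_mul_pi hk0 hk1,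
    ellipticF_am hk0 hk1]

/-- The inverse of an order isomorphism of `ℝ` is continuous. The inverse function rule in
`hasDerivAt_am` needs this. -/
lemma continuous_am (hk0 : 0 ≤ k) (hk1 : k < 1) : Continuous fun u => am u k := by
  let e := (strictMono_ellipticF hk0 hk1).orderIsoOfSurjective _ (surjective_ellipticF hk0 hk1)
  have : (fun u => am u k) = e.symm := by
    funext u
    rw [eq_comm, OrderIso.symm_apply_eq]
    exact (ellipticF_am hk0 hk1 u).symm
  rw [this]
  exact e.symm.continuous

lemma dn_pos (hk0 : 0 ≤ k) (hk1 : k < 1) (u : ℝ) : 0 < dn u k :=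
  Real.sqrt_pos.2 (one_sub_sq_mul_sin_sq_pos (sq_nonneg k) (by nlinarith) _)

lemma dn_sq (hk0 : 0 ≤ k) (hk1 : k < 1) (u : ℝ) : dn u k ^ 2 = 1 - k ^ 2 * sn u k ^ 2 :=
  Real.sq_sqrt (one_sub_sq_mul_sin_sq_pos (sq_nonneg k) (by nlinarith) _).le

lemma sn_sq_add_cn_sq (u : ℝ) : sn u k ^ 2 + cn u k ^ 2 = 1 := Real.sin_sq_add_cos_sq _

lemma hasDerivAt_am (hk0 : 0 ≤ k) (hk1 : k < 1) (u : ℝ) :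
    HasDerivAt (fun u => am u k) (dn u k) u := by
  have h := HasDerivAt.of_local_left_inverse (continuous_am hk0 hk1).continuousAt
    (hasDerivAt_ellipticF hk0 hk1 (am u k))
    (one_div_pos.2 (dn_pos hk0 hk1 u)).ne' (Filter.Eventually.of_forall (ellipticF_am hk0 hk1))
  simpa [dn, sn] using h

lemma hasDerivAt_sn (hk0 : 0 ≤ k) (hk1 : k < 1) (u : ℝ) :
    HasDerivAt (fun u => sn u k) (cn u k * dn u k) u :=
  (hasDerivAt_am hk0 hk1 u).sin

lemma hasDerivAt_cn (hk0 : 0 ≤ k) (hk1 : k < 1) (u : ℝ) :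
    HasDerivAt (fun u => cn u k) (-sn u k * dn u k) u :=
  (hasDerivAt_am hk0 hk1 u).cos

lemma hasDerivAt_sqrt_one_sub_mul_sn_sq {c : ℝ} (hk0 : 0 ≤ k) (hk1 : k < 1) (hc0 : 0 ≤ c)
    (hc1 : c < 1) (u : ℝ) :
    HasDerivAt (fun u => Real.sqrt (1 - c * sn u k ^ 2))
      (-(c * sn u k * cn u k * dn u k) / Real.sqrt (1 - c * sn u k ^ 2)) u := by
  have hpos : 0 < 1 - c * sn u k ^ 2 := one_sub_sq_mul_sin_sq_pos hc0 hc1 _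
  have h := ((((hasDerivAt_sn hk0 hk1 u).pow 2).const_mul c).const_sub 1).sqrt hpos.ne'
  have hne := (Real.sqrt_pos.2 hpos).ne'
  refine h.congr_deriv ?_
  simp only [Pi.pow_apply, Nat.cast_ofNat, Nat.add_one_sub_one, pow_one]
  field_simp

lemma hasDerivAt_dn (hk0 : 0 ≤ k) (hk1 : k < 1) (u : ℝ) :
    HasDerivAt (fun u => dn u k) (-(k ^ 2 * sn u k * cn u k)) u := by
  have h := hasDerivAt_sqrt_one_sub_mul_sn_sq hk0 hk1 (sq_nonneg k) (by nlinarith) u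
  have hd := (dn_pos hk0 hk1 u).ne'
  refine h.congr_deriv ?_
  change _ / dn u k = _
  field_simp

lemma hasDerivAt_ellipticE_am (hk0 : 0 ≤ k) (hk1 : k < 1) (u : ℝ) :
    HasDerivAt (fun u => ellipticE (am u k) k) (dn u k ^ 2) u := by
  have h := (hasDerivAt_ellipticE (k := k) (am u k)).comp u (hasDerivAt_am hk0 hk1 u)
  rw [sq]
  exact h

lemma hasDerivAt_ellipticPi_am (hk0 : 0 ≤ k) (hk1 : k < 1) (hn0 : 0 ≤ n) (hn1 : n < 1) (u : ℝ) :
    HasDerivAt (fun u => ellipticPi (am u k) n k) (1 / (1 - n * sn u k ^ 2)) u := by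
  have h := (hasDerivAt_ellipticPi hk0 hk1 hn0 hn1 (am u k)).comp u (hasDerivAt_am hk0 hk1 u)
  have h1 : 1 - n * sn u k ^ 2 ≠ 0 := (one_sub_sq_mul_sin_sq_pos hn0 hn1 _).ne'
  have hd := (dn_pos hk0 hk1 u).ne'
  refine h.congr_deriv ?_
  change 1 / ((1 - n * sn u k ^ 2) * dn u k) * dn u k = _
  field_simp

lemma exists_am_eq_int_mul_pi {u : ℝ} (h : sn u k = 0) : ∃ j : ℤ, am u k = j * Real.pi := by
  obtain ⟨j, hj⟩ := Real.sin_eq_zero_iff.1 h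
  exact ⟨j, hj.symm⟩

lemma am_add_two_periods (hk0 : 0 ≤ k) (hk1 : k < 1) (u : ℝ) (j : ℤ) :
    am (u + 4 * j * completeK k) k = am u k + j * (2 * Real.pi) := by
  have := am_add hk0 hk1 u (2 * j)
  push_cast at this
  rw [show u + 4 * j * completeK k = u + 2 * (2 * j) * completeK k by ring, this]
  ring

lemma sn_add_two_periods (hk0 : 0 ≤ k) (hk1 : k < 1) (u : ℝ) (j : ℤ) :
    sn (u + 4 * j * completeK k) k = sn u k := by
  rw [sn, am_add_two_periods hk0 hk1, Real.sin_add_int_mul_two_pi, sn]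

lemma cn_add_two_periods (hk0 : 0 ≤ k) (hk1 : k < 1) (u : ℝ) (j : ℤ) :
    cn (u + 4 * j * completeK k) k = cn u k := by
  rw [cn, am_add_two_periods hk0 hk1, Real.cos_add_int_mul_two_pi, cn]

lemma dn_add_two_periods (hk0 : 0 ≤ k) (hk1 : k < 1) (u : ℝ) (j : ℤ) :
    dn (u + 4 * j * completeK k) k = dn u k := by
  rw [dn, sn_add_two_periods hk0 hk1, dn]

end Modulus

/-! ### Periods of surfaces generated by the screw motions of the helicoid -/

lemma ofCR_inj {X Y : ℂ} {z w : ℝ} : ofCR X z = ofCR Y w ↔ X = Y ∧ z = w := by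
  constructor
  · intro h
    have h0 := congrArg (fun a : E3 => a 0) h
    have h1 := congrArg (fun a : E3 => a 1) h
    have h2 := congrArg (fun a : E3 => a 2) h
    simp only [ofCR] at h0 h1 h2
    exact ⟨Complex.ext h0 h1, h2⟩
  · rintro ⟨rfl, rfl⟩; rfl

/-- The surface swept out by the curve `(C, T + (b - 1/b) u - b E(am u))` of `ℂ × ℝ`, turned by
the angle `g`, under the screw motions of the helicoid, and scaled by `κ`. -/
def screwSurface (κ μ b : ℝ) (C : ℝ → ℂ) (T : ℝ → ℝ) (p : ℝ × ℝ) : E3 :=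
  κ • ofCR (Complex.exp (Complex.I * ((p.2 / b : ℝ) : ℂ)) *
      Complex.exp (Complex.I * (g μ b p.1 : ℂ)) * C p.1)
    (T p.1 + ((b - 1 / b) * p.1 - b * ellipticE (am p.1 μ) μ) + c₁ μ b * p.2 / b)

section Parameters

variable {μ b : ℝ}

lemma modulus_lt_one (hμ : 0 < μ) (hb : 1 < b) (hμb : μ * b < 1) : μ < 1 := by nlinarith

lemma characteristic_lt_one (hμ : 0 < μ) (hb : 1 < b) (hμb : μ * b < 1) :
    μ ^ 2 * b ^ 2 < 1 := by
  have : 0 < μ * b := by positivity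
  nlinarith

lemma c₁_sq (hμ : 0 < μ) (hb : 1 < b) (hμb : μ * b < 1) :
    c₁ μ b ^ 2 = (1 - μ ^ 2 * b ^ 2) * (b ^ 2 - 1) :=
  Real.sq_sqrt (mul_nonneg (by linarith [characteristic_lt_one hμ hb hμb]) (by nlinarith))

lemma c₁_pos (hμ : 0 < μ) (hb : 1 < b) (hμb : μ * b < 1) : 0 < c₁ μ b :=
  Real.sqrt_pos.2 (mul_pos (by linarith [characteristic_lt_one hμ hb hμb]) (by nlinarith))

lemma g_of_am_eq (hμ : 0 < μ) (hb : 1 < b) (hμb : μ * b < 1) {u w : ℝ} {j : ℤ}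
    (h : am w μ = am u μ + j * Real.pi) :
    g μ b w = g μ b u + c₁ μ b / b * (2 * j * completePi (μ ^ 2 * b ^ 2) μ) := by
  rw [g, h, ellipticPi_add_int_mul_pi hμ.le (modulus_lt_one hμ hb hμb) (by positivity)
    (characteristic_lt_one hμ hb hμb), g]
  ring

lemma g_zero (hμ : 0 < μ) (hb : 1 < b) (hμb : μ * b < 1) : g μ b 0 = 0 := by
  simp [g, am_zero hμ.le (modulus_lt_one hμ hb hμb)]

/-- If a translation by `2 j K` in `u` and `h` in `v` does not change the height, then it turns
the surface by the angle `2 j π Φ`. -/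
lemma angle_eq (hμ : 0 < μ) (hb : 1 < b) (hμb : μ * b < 1) {j h : ℝ}
    (hh : (b - 1 / b) * (2 * j * completeK μ) - b * (2 * j * completeE μ) + c₁ μ b * h / b = 0) :
    h / b + c₁ μ b / b * (2 * j * completePi (μ ^ 2 * b ^ 2) μ) = 2 * j * (Real.pi * Φ μ b) := by
  have hc := (c₁_pos hμ hb hμb).ne'
  have hb0 : b ≠ 0 := by positivity
  have hπ := Real.pi_ne_zero
  rw [Φ]
  field_simp at hh ⊢
  linear_combination hh

/-- The period is tested only at the origin. The sign in `hC` is needed for the companion, whose `C`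
changes sign under `u ↦ u + 2K`. -/
lemma phi_rational_of_hasPeriod {κ : ℝ} {C : ℝ → ℂ} {T : ℝ → ℝ} (hκ : κ ≠ 0)
    (hμ : 0 < μ) (hb : 1 < b) (hμb : μ * b < 1) (hC0 : C 0 ≠ 0)
    (hC : ∀ u, ‖C u‖ = ‖C 0‖ → sn u μ = 0 ∧ T u = 0 ∧ (C u = C 0 ∨ C u = -C 0))
    (hper : HasPeriod (screwSurface κ μ b C T)) : ∃ q : ℚ, Φ μ b = (q : ℝ) := by
  have hμ1 := modulus_lt_one hμ hb hμb
  have ham0 := am_zero hμ.le hμ1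
  obtain ⟨⟨p, h⟩, hne, hp⟩ := hper
  have hp0 := hp (0, 0)
  obtain ⟨hX, hz⟩ := ofCR_inj.1 (smul_right_injective E3 hκ hp0)
  simp only [Prod.mk_add_mk, zero_add, g_zero hμ hb hμb, ham0, ellipticE_zero, zero_div,
    Complex.ofReal_zero, mul_zero, Complex.exp_zero, one_mul, sub_zero, add_zero] at hX hz
  rw [(hC 0 rfl).2.1] at hz
  rw [← Complex.exp_add, ← mul_add, ← Complex.ofReal_add, mul_comm Complex.I] at hX
  have hnorm : ‖C p‖ = ‖C 0‖ := by
    rw [← hX, norm_mul, Complex.norm_exp_ofReal_mul_I, one_mul]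
  obtain ⟨hs, hT, hCp⟩ := hC p hnorm
  obtain ⟨j, hj⟩ := exists_am_eq_int_mul_pi hs
  have hj' : am p μ = am 0 μ + j * Real.pi := by rw [hj, ham0, zero_add]
  have hpK : p = 2 * j * completeK μ := by
    rw [← ellipticF_am hμ.le hμ1 p, hj', ellipticF_add_int_mul_pi hμ.le hμ1, ham0]
    simp
  have hE : ellipticE (am p μ) μ = 2 * j * completeE μ := by
    rw [hj', ellipticE_add_int_mul_pi, ham0]; simp
  rw [hT, hE, zero_add, hpK] at hz
  have hangle := angle_eq hμ hb hμb hz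
  have hg := g_of_am_eq hμ hb hμb hj'
  rw [g_zero hμ hb hμb, zero_add] at hg
  rw [hg, hangle] at hX
  -- If `j = 0`, then `p = 0`, and the height equation forces `h = 0` because `c₁ ≠ 0`.
  have hj0 : (j : ℝ) ≠ 0 := by
    intro hj0
    rw [hj0] at hz hpK
    have hc := (c₁_pos hμ hb hμb).ne'
    have hb0 : b ≠ 0 := by positivity
    have hh0 : h = 0 := by
      field_simp at hz
      simpa [hc] using hz
    apply hne
    simp [hh0, hpK]
  have hsin : Real.sin (2 * j * (Real.pi * Φ μ b)) = 0 := by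
    rw [← Complex.exp_ofReal_mul_I_im]
    rcases hCp with h1 | h1 <;> rw [h1] at hX
    · rw [mul_eq_right₀ hC0] at hX
      rw [hX, Complex.one_im]
    · have : Complex.exp ((2 * j * (Real.pi * Φ μ b) : ℝ) * Complex.I) = -1 := by
        apply mul_right_cancel₀ hC0
        linear_combination -hX
      rw [this]; simp
  obtain ⟨n, hn⟩ := Real.sin_eq_zero_iff.1 hsin
  -- This solves `2 j π Φ = n π`.
  refine ⟨(n : ℚ) / (2 * j), ?_⟩
  push_cast
  have hπ := Real.pi_ne_zero
  field_simp
  apply mul_left_cancel₀ hπ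
  linear_combination -hn

lemma hasPeriod_of_phi_rational (κ : ℝ) {C : ℝ → ℂ} {T : ℝ → ℝ}
    (hμ : 0 < μ) (hb : 1 < b) (hμb : μ * b < 1)
    (hC : ∀ (u : ℝ) (j : ℤ), C (u + 4 * j * completeK μ) = C u)
    (hT : ∀ (u : ℝ) (j : ℤ), T (u + 4 * j * completeK μ) = T u)
    (hΦ : ∃ q : ℚ, Φ μ b = (q : ℝ)) : HasPeriod (screwSurface κ μ b C T) := by
  obtain ⟨q, hq⟩ := hΦ
  have hμ1 := modulus_lt_one hμ hb hμb
  have hc := (c₁_pos hμ hb hμb).ne'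
  have hb0 : b ≠ 0 := by positivity
  have hK := completeK_pos hμ.le hμ1
  set m : ℤ := (q.den : ℤ) with hm
  have hm0 : (m : ℝ) ≠ 0 := by simp [hm]
  -- An even `j` is taken because `sn` and `cn` change sign under `2K` and only return after `4K`.
  set j : ℤ := 2 * m with hj
  have hjr : (j : ℝ) = 2 * m := by simp [hj]
  -- The unique `v`-shift that compensates the change of height.
  set h : ℝ := -(b / c₁ μ b) * ((b - 1 / b) * (2 * j * completeK μ) - b * (2 * j * completeE μ))
    with hh
  have hz : (b - 1 / b) * (2 * j * completeK μ) - b * (2 * j * completeE μ) + c₁ μ b * h / b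
      = 0 := by
    rw [hh]; field_simp; ring
  have hangle := angle_eq hμ hb hμb hz
  have hturn : 2 * (j : ℝ) * (Real.pi * Φ μ b) = (2 * q.num : ℤ) * (2 * Real.pi) := by
    have : (m : ℝ) * (q : ℝ) = q.num := by
      have := q.den_mul_eq_num
      rw [hm]
      exact_mod_cast this
    rw [hjr, hq]
    push_cast
    linear_combination 4 * Real.pi * this
  refine ⟨(4 * m * completeK μ, h), ?_, ?_⟩
  · intro h0
    have := congrArg Prod.fst h0
    simp [hm0, hK.ne'] at this
  · rintro ⟨u, v⟩
    have ham := am_add hμ.le hμ1 u j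
    rw [hjr, show u + 2 * (2 * (m : ℝ)) * completeK μ = u + 4 * m * completeK μ by ring,
      ← hjr] at ham
    simp only [screwSurface, Prod.mk_add_mk]
    congr 1
    refine ofCR_inj.2 ⟨?_, ?_⟩
    · rw [hC]
      congr 1
      rw [g_of_am_eq hμ hb hμb ham, ← Complex.exp_add, ← Complex.exp_add, ← mul_add, ← mul_add,
        ← Complex.ofReal_add, ← Complex.ofReal_add]
      have : (v + h) / b + (g μ b u + c₁ μ b / b * (2 * j * completePi (μ ^ 2 * b ^ 2) μ)) =
          (v / b + g μ b u) + (2 * q.num : ℤ) * (2 * Real.pi) := by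
        rw [← hturn, ← hangle]; ring
      rw [this, Complex.exp_eq_exp_iff_exists_int]
      refine ⟨2 * q.num, ?_⟩
      push_cast
      ring
    · rw [hT, ham, ellipticE_add_int_mul_pi]
      rw [hjr] at hz ⊢
      linear_combination hz

end Parameters

/-! ### The Gauss map of the helicoid -/

lemma hasDerivAt_ofCR {X : ℝ → ℂ} {z : ℝ → ℝ} {X' : ℂ} {z' t : ℝ} (hX : HasDerivAt X X' t)
    (hz : HasDerivAt z z' t) :
    HasDerivAt (fun s => ofCR (X s) (z s)) (ofCR X' z') t := by
  have hre : HasDerivAt (fun s => (X s).re) X'.re t :=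
    Complex.reCLM.hasFDerivAt.comp_hasDerivAt t hX
  have him : HasDerivAt (fun s => (X s).im) X'.im t :=
    Complex.imCLM.hasFDerivAt.comp_hasDerivAt t hX
  have h : HasDerivAt (fun s => ![(X s).re, (X s).im, z s]) ![X'.re, X'.im, z'] t := by
    rw [hasDerivAt_pi]
    intro i
    fin_cases i
    · exact hre
    · exact him
    · exact hz
  exact (PiLp.continuousLinearEquiv 2 ℝ fun _ : Fin 3 => ℝ).symm.hasFDerivAt.comp_hasDerivAt t h

lemma ofCR_add (X Y : ℂ) (z w : ℝ) : ofCR X z + ofCR Y w = ofCR (X + Y) (z + w) := by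
  ext i; fin_cases i <;> simp [ofCR]

lemma smul_ofCR (a : ℝ) (X : ℂ) (z : ℝ) : a • ofCR X z = ofCR (a * X) (a * z) := by
  ext i; fin_cases i <;> simp [ofCR]

lemma norm_ofCR (X : ℂ) (z : ℝ) : ‖ofCR X z‖ = Real.sqrt (‖X‖ ^ 2 + z ^ 2) := by
  rw [EuclideanSpace.norm_eq, Fin.sum_univ_three, ← Complex.normSq_eq_norm_sq,
    Complex.normSq_apply]
  simp [ofCR, sq]

/-- A cross product in a frame rotated about the vertical axis by the unit complex number `e`. -/
lemma cross_ofCR (e X Y : ℂ) (he : ‖e‖ = 1) (z w : ℝ) :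
    WithLp.toLp 2 (crossProduct (WithLp.ofLp (ofCR (e * X) z)) (WithLp.ofLp (ofCR (e * Y) w))) =
      ofCR (e * ⟨X.im * w - z * Y.im, z * Y.re - X.re * w⟩) (X.re * Y.im - X.im * Y.re) := by
  have h : e.re * e.re + e.im * e.im = 1 := by
    rw [← Complex.normSq_apply, Complex.normSq_eq_norm_sq, he, one_pow]
  ext i
  fin_cases i
  · simp [ofCR, cross_apply]; ring
  · simp [ofCR, cross_apply]; ring
  · simp [ofCR, cross_apply]
    linear_combination (X.re * Y.im - X.im * Y.re) * h

section Parameters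

variable {μ b : ℝ}

lemma rad_pos (hμ : 0 < μ) (hb : 1 < b) (hμb : μ * b < 1) (u : ℝ) : 0 < rad μ b u :=
  Real.sqrt_pos.2 (one_sub_sq_mul_sin_sq_pos (by positivity) (characteristic_lt_one hμ hb hμb) _)

lemma rad_sq (hμ : 0 < μ) (hb : 1 < b) (hμb : μ * b < 1) (u : ℝ) :
    rad μ b u ^ 2 = 1 - μ ^ 2 * b ^ 2 * sn u μ ^ 2 :=
  Real.sq_sqrt
    (one_sub_sq_mul_sin_sq_pos (by positivity) (characteristic_lt_one hμ hb hμb) _).le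

/-- The real part of `profileC`. -/
def profileRe (μ b u : ℝ) : ℝ := rad μ b u + μ * b ^ 2 * cn u μ * dn u μ / rad μ b u

/-- The imaginary part of `profileC`. -/
def profileIm (μ b u : ℝ) : ℝ := -(μ * b * c₁ μ b * sn u μ / rad μ b u)

lemma profileC_eq (u : ℝ) :
    profileC μ b u = (profileRe μ b u : ℂ) + (profileIm μ b u : ℂ) * Complex.I := by
  simp only [profileC, profileRe, profileIm]
  push_cast
  ring

lemma hasDerivAt_rad (hμ : 0 < μ) (hb : 1 < b) (hμb : μ * b < 1) (u : ℝ) :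
    HasDerivAt (rad μ b) (-(μ ^ 2 * b ^ 2 * sn u μ * cn u μ * dn u μ) / rad μ b u) u :=
  hasDerivAt_sqrt_one_sub_mul_sn_sq hμ.le (modulus_lt_one hμ hb hμb) (by positivity)
    (characteristic_lt_one hμ hb hμb) u

lemma hasDerivAt_g (hμ : 0 < μ) (hb : 1 < b) (hμb : μ * b < 1) (u : ℝ) :
    HasDerivAt (g μ b) (c₁ μ b / b * (1 / rad μ b u ^ 2)) u := by
  rw [rad_sq hμ hb hμb]
  exact (hasDerivAt_ellipticPi_am hμ.le (modulus_lt_one hμ hb hμb) (by positivity)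
    (characteristic_lt_one hμ hb hμb) u).const_mul _

lemma hasDerivAt_profileR (hμ : 0 < μ) (hb : 1 < b) (hμb : μ * b < 1) (u : ℝ) :
    HasDerivAt (profileR μ b) (-(profileRe μ b u * rad μ b u / b)) u := by
  have hμ1 := modulus_lt_one hμ hb hμb
  have h := ((hasDerivAt_sn hμ.le hμ1 u).const_mul (μ * b)).fun_neg.fun_add
    (((hasDerivAt_id' u).const_mul (b - 1 / b)).fun_sub
      ((hasDerivAt_ellipticE_am hμ.le hμ1 u).const_mul b))
  refine h.congr_deriv ?_
  have hr := (rad_pos hμ hb hμb u).ne'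
  have hr2 := rad_sq hμ hb hμb u
  have hd2 := dn_sq hμ.le hμ1 u
  have hb0 : b ≠ 0 := by positivity
  rw [profileRe]
  field_simp
  linear_combination hr2 - b ^ 2 * hd2

/-- The term with `profileIm` is `g'` times it and cancels against the derivative of `e^{ig}`. In
the rotating frame the real part of the `u`-tangent is then just `-μ sn · profileRe`;
`hasDerivAt_profileIm` has its form for the same reason. -/
lemma hasDerivAt_profileRe (hμ : 0 < μ) (hb : 1 < b) (hμb : μ * b < 1) (u : ℝ) :
    HasDerivAt (profileRe μ b)
      (c₁ μ b / b * (1 / rad μ b u ^ 2) * profileIm μ b u - μ * sn u μ * profileRe μ b u) u := by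
  have hμ1 := modulus_lt_one hμ hb hμb
  have hr := (rad_pos hμ hb hμb u).ne'
  have h := (hasDerivAt_rad hμ hb hμb u).fun_add
    ((((hasDerivAt_cn hμ.le hμ1 u).const_mul (μ * b ^ 2)).fun_mul
      (hasDerivAt_dn hμ.le hμ1 u)).fun_div (hasDerivAt_rad hμ hb hμb u) hr)
  refine h.congr_deriv ?_
  have hr2 := rad_sq hμ hb hμb u
  have hd2 := dn_sq hμ.le hμ1 u
  have hc2 := c₁_sq hμ hb hμb
  have hsc := sn_sq_add_cn_sq (k := μ) u
  have hb0 : b ≠ 0 := by positivity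
  rw [profileRe, profileIm]
  generalize rad μ b u = r at *
  generalize sn u μ = s at *
  generalize cn u μ = c at *
  generalize dn u μ = d at *
  generalize c₁ μ b = C at *
  have hc : c ^ 2 = 1 - s ^ 2 := by linarith
  -- Clearing denominators leaves `s` times this relation, which becomes polynomial in `s` once all
  -- squares are eliminated.
  have key : b ^ 2 * d ^ 2 * r ^ 2 + μ ^ 2 * b ^ 2 * c ^ 2 * r ^ 2 - μ ^ 2 * b ^ 4 * c ^ 2 * d ^ 2 =
      C ^ 2 + (r ^ 2) ^ 2 := by
    rw [hc, hr2, hd2, hc2]; ring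
  field_simp
  linear_combination (-s) * key

lemma hasDerivAt_profileIm (hμ : 0 < μ) (hb : 1 < b) (hμb : μ * b < 1) (u : ℝ) :
    HasDerivAt (profileIm μ b)
      (c₁ μ b / (b * rad μ b u) - c₁ μ b / b * (1 / rad μ b u ^ 2) * profileRe μ b u) u := by
  have hμ1 := modulus_lt_one hμ hb hμb
  have hr := (rad_pos hμ hb hμb u).ne'
  have h := (((hasDerivAt_sn hμ.le hμ1 u).const_mul (μ * b * c₁ μ b)).fun_div
      (hasDerivAt_rad hμ hb hμb u) hr).fun_neg
  refine h.congr_deriv ?_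
  have hr2 := rad_sq hμ hb hμb u
  have hb0 : b ≠ 0 := by positivity
  rw [profileRe]
  field_simp
  linear_combination (-c₁ μ b * μ * b ^ 2 * cn u μ * dn u μ) * hr2

/-- The rotation factor `e^{iv/b} e^{ig(u)}`. -/
def rotation (μ b u v : ℝ) : ℂ :=
  Complex.exp (Complex.I * ((v / b : ℝ) : ℂ)) * Complex.exp (Complex.I * (g μ b u : ℂ))

lemma norm_rotation (u v : ℝ) : ‖rotation μ b u v‖ = 1 := by
  rw [rotation, norm_mul, Complex.norm_exp_I_mul_ofReal, Complex.norm_exp_I_mul_ofReal, one_mul]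

lemma hasDerivAt_cmcHelicoid_fst (H : ℝ) (hμ : 0 < μ) (hb : 1 < b) (hμb : μ * b < 1)
    (u v : ℝ) :
    HasDerivAt (fun s => cmcHelicoid H μ b (s, v))
      ((-(1 / (2 * H))) • ofCR (rotation μ b u v *
        ⟨-(μ * sn u μ * profileRe μ b u), c₁ μ b / (b * rad μ b u)⟩)
        (-(profileRe μ b u * rad μ b u / b))) u := by
  have hg := ((hasDerivAt_g hμ hb hμb u).ofReal_comp.const_mul Complex.I).cexp
  have hP := (hasDerivAt_profileRe hμ hb hμb u).ofReal_comp.fun_add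
    ((hasDerivAt_profileIm hμ hb hμb u).ofReal_comp.mul_const Complex.I)
  have hX := (hg.const_mul (Complex.exp (Complex.I * ((v / b : ℝ) : ℂ)))).fun_mul hP
  simp only [← profileC_eq] at hX
  have hz := (hasDerivAt_profileR hμ hb hμb u).add_const (c₁ μ b * v / b)
  refine ((hasDerivAt_ofCR hX hz).const_smul (-(1 / (2 * H)))).congr_deriv ?_
  congr 2
  rw [rotation, profileC_eq, Complex.mk_eq_add_mul_I]
  push_cast
  ring_nf
  rw [Complex.I_sq]
  ring

lemma hasDerivAt_cmcHelicoid_snd (H : ℝ) (u v : ℝ) :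
    HasDerivAt (fun t => cmcHelicoid H μ b (u, t))
      ((-(1 / (2 * H))) • ofCR (rotation μ b u v *
        ⟨-(profileIm μ b u / b), profileRe μ b u / b⟩) (c₁ μ b / b)) v := by
  have hv := ((((hasDerivAt_id' v).div_const b).ofReal_comp.const_mul Complex.I).cexp.mul_const
    (Complex.exp (Complex.I * (g μ b u : ℂ)))).mul_const (profileC μ b u)
  have hz := (((hasDerivAt_id' v).const_mul (c₁ μ b)).div_const b).const_add (profileR μ b u)
  refine ((hasDerivAt_ofCR hv hz).const_smul (-(1 / (2 * H)))).congr_deriv ?_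
  rw [mul_one]
  congr 2
  rw [rotation, profileC_eq, Complex.mk_eq_add_mul_I]
  push_cast
  ring_nf
  rw [Complex.I_sq]
  ring

/-- The conformal factor of `-2H x`. -/
def conformalFactor (μ b u : ℝ) : ℝ :=
  (profileRe μ b u ^ 2 + profileIm μ b u ^ 2 + c₁ μ b ^ 2) / b ^ 2

lemma conformalFactor_pos (hμ : 0 < μ) (hb : 1 < b) (hμb : μ * b < 1) (u : ℝ) :
    0 < conformalFactor μ b u := by
  have := c₁_pos hμ hb hμb
  unfold conformalFactor
  positivity

/-- Both tangent vectors carry the same rotation, so the product is computed in the rotating frame.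
The scale enters squared, so the sign of `H` does not affect the direction. -/
lemma normalVector_cmcHelicoid (H : ℝ) (hμ : 0 < μ) (hb : 1 < b) (hμb : μ * b < 1) (u v : ℝ) :
    normalVector (cmcHelicoid H μ b) (u, v) =
      ((1 / (2 * H)) ^ 2 * conformalFactor μ b u) •
        ofCR (rotation μ b u v * rad μ b u) (-(μ * b * sn u μ)) := by
  rw [normalVector, (hasDerivAt_cmcHelicoid_fst H hμ hb hμb u v).deriv,
    (hasDerivAt_cmcHelicoid_snd H u v).deriv, WithLp.ofLp_smul, WithLp.ofLp_smul, map_smul,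
    map_smul, LinearMap.smul_apply, smul_smul, WithLp.toLp_smul,
    cross_ofCR _ _ _ (norm_rotation u v),
    neg_mul_neg, ← sq, mul_smul, smul_ofCR (conformalFactor μ b u)]
  have hr := (rad_pos hμ hb hμb u).ne'
  have hr2 := rad_sq hμ hb hμb u
  have hb0 : b ≠ 0 := by positivity
  congr 1
  refine ofCR_inj.2 ⟨?_, ?_⟩
  · rw [mul_left_comm]
    congr 1
    rw [conformalFactor, profileIm]
    apply Complex.ext
    · simp only [Complex.re_mul_ofReal, Complex.ofReal_re]
      field_simp
      linear_combination -c₁ μ b ^ 2 * hr2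
    · simp only [Complex.im_mul_ofReal, Complex.ofReal_im]
      field_simp
      ring
  · rw [conformalFactor, profileIm]
    field_simp
    linear_combination sn u μ * c₁ μ b ^ 2 * hr2

lemma gaussMap_cmcHelicoid {H : ℝ} (hH : H ≠ 0) (hμ : 0 < μ) (hb : 1 < b) (hμb : μ * b < 1)
    (u v : ℝ) :
    gaussMap (cmcHelicoid H μ b) (u, v) =
      ofCR (rotation μ b u v * rad μ b u) (-(μ * b * sn u μ)) := by
  have hpos : 0 < (1 / (2 * H)) ^ 2 * conformalFactor μ b u :=
    mul_pos (by positivity) (conformalFactor_pos hμ hb hμb u)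
  -- This is `rad² + μ² b² sn² = 1`.
  have hunit : ‖ofCR (rotation μ b u v * rad μ b u) (-(μ * b * sn u μ))‖ = 1 := by
    rw [norm_ofCR, norm_mul, norm_rotation, one_mul, Complex.norm_real, Real.norm_eq_abs, sq_abs,
      rad_sq hμ hb hμb, Real.sqrt_eq_one]
    ring
  rw [gaussMap, normalVector_cmcHelicoid H hμ hb hμb, norm_smul, hunit, mul_one,
    Real.norm_of_nonneg hpos.le, inv_smul_smul₀ hpos.ne']

/-! ### The helicoid and its companion as screw surfaces -/

lemma cmcHelicoid_eq_screwSurface (H : ℝ) :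
    cmcHelicoid H μ b =
      screwSurface (-(1 / (2 * H))) μ b (profileC μ b) fun u => -(μ * b * sn u μ) :=
  rfl

lemma cgcCompanion_eq_screwSurface {H : ℝ} (hH : H ≠ 0) (hμ : 0 < μ) (hb : 1 < b)
    (hμb : μ * b < 1) :
    cgcCompanion H (cmcHelicoid H μ b) =
      screwSurface (-(1 / (2 * H))) μ b (fun u => profileC μ b u - rad μ b u) fun _ => 0 := by
  funext ⟨u, v⟩
  rw [cgcCompanion, gaussMap_cmcHelicoid hH hμ hb hμb, cmcHelicoid, screwSurface]
  simp only [smul_ofCR, ofCR_add]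
  refine ofCR_inj.2 ⟨?_, ?_⟩
  · rw [rotation]
    push_cast
    ring
  · rw [profileR]
    ring

lemma norm_profileC_sq (u : ℝ) :
    ‖profileC μ b u‖ ^ 2 = profileRe μ b u ^ 2 + profileIm μ b u ^ 2 := by
  rw [profileC_eq, ← Complex.normSq_eq_norm_sq, Complex.normSq_add_mul_I]

lemma norm_profileC_sq_eq (hμ : 0 < μ) (hb : 1 < b) (hμb : μ * b < 1) (u : ℝ) :
    ‖profileC μ b u‖ ^ 2 = b ^ 2 * (μ * cn u μ + dn u μ) ^ 2 - c₁ μ b ^ 2 := by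
  have hr := (rad_pos hμ hb hμb u).ne'
  have hr2 := rad_sq hμ hb hμb u
  have hd2 := dn_sq hμ.le (modulus_lt_one hμ hb hμb) u
  have hc2 := c₁_sq hμ hb hμb
  have hcn : cn u μ ^ 2 = 1 - sn u μ ^ 2 := by linarith [sn_sq_add_cn_sq (k := μ) u]
  rw [norm_profileC_sq, profileRe, profileIm]
  -- Clearing the denominator `rad` produces a fourth power, which the rule for `rad²` does not
  -- rewrite.
  have hr4 : rad μ b u ^ 4 = (1 - μ ^ 2 * b ^ 2 * sn u μ ^ 2) ^ 2 := by rw [← hr2]; ring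
  field_simp
  ring_nf
  simp only [hr4, hr2, hd2, hc2, hcn]
  ring

lemma norm_companion_sq (hμ : 0 < μ) (hb : 1 < b) (hμb : μ * b < 1) (u : ℝ) :
    ‖profileC μ b u - rad μ b u‖ ^ 2 = μ ^ 2 * b ^ 2 * (b ^ 2 - sn u μ ^ 2) := by
  have hr := (rad_pos hμ hb hμb u).ne'
  have hr2 := rad_sq hμ hb hμb u
  have hd2 := dn_sq hμ.le (modulus_lt_one hμ hb hμb) u
  have hc2 := c₁_sq hμ hb hμb
  have hcn : cn u μ ^ 2 = 1 - sn u μ ^ 2 := by linarith [sn_sq_add_cn_sq (k := μ) u]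
  have : profileC μ b u - rad μ b u =
      ((profileRe μ b u - rad μ b u : ℝ) : ℂ) + (profileIm μ b u : ℂ) * Complex.I := by
    rw [profileC_eq]; push_cast; ring
  rw [this, ← Complex.normSq_eq_norm_sq, Complex.normSq_add_mul_I, profileRe, profileIm,
    add_sub_cancel_left]
  field_simp
  ring_nf
  simp only [hr2, hd2, hc2, hcn]
  ring

lemma sn_zero (hμ : 0 < μ) (hμ1 : μ < 1) : sn 0 μ = 0 := by
  rw [sn, am_zero hμ.le hμ1, Real.sin_zero]

lemma cn_zero (hμ : 0 < μ) (hμ1 : μ < 1) : cn 0 μ = 1 := by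
  rw [cn, am_zero hμ.le hμ1, Real.cos_zero]

lemma dn_of_sn_eq_zero {u : ℝ} (h : sn u μ = 0) : dn u μ = 1 := by simp [dn, h]

lemma rad_of_sn_eq_zero {u : ℝ} (h : sn u μ = 0) : rad μ b u = 1 := by simp [rad, h]

lemma profileC_of_sn_eq_zero {u : ℝ} (h : sn u μ = 0) :
    profileC μ b u = 1 + μ * b ^ 2 * cn u μ := by
  rw [profileC, rad_of_sn_eq_zero h, dn_of_sn_eq_zero h, h]
  push_cast
  ring

lemma profileC_add_two_periods (hμ : 0 < μ) (hμ1 : μ < 1) (u : ℝ) (j : ℤ) :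
    profileC μ b (u + 4 * j * completeK μ) = profileC μ b u := by
  simp only [profileC, rad, sn_add_two_periods hμ.le hμ1, cn_add_two_periods hμ.le hμ1,
    dn_add_two_periods hμ.le hμ1]

lemma rad_add_two_periods (hμ : 0 < μ) (hμ1 : μ < 1) (u : ℝ) (j : ℤ) :
    rad μ b (u + 4 * j * completeK μ) = rad μ b u := by
  simp only [rad, sn_add_two_periods hμ.le hμ1]

/-- Equal norms give `μ cn + dn = ±(μ + 1)`. Since `cn ≤ 1` and `dn ≤ 1`, the plus sign forces `cn =
1`; the minus sign is impossible because `μ cn + dn > -μ`. -/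
lemma cn_eq_one_of_norm_profileC_eq (hμ : 0 < μ) (hb : 1 < b) (hμb : μ * b < 1) {u : ℝ}
    (h : ‖profileC μ b u‖ = ‖profileC μ b 0‖) : cn u μ = 1 := by
  have hμ1 := modulus_lt_one hμ hb hμb
  have h2 := norm_profileC_sq_eq hμ hb hμb u
  rw [h, norm_profileC_sq_eq hμ hb hμb, cn_zero hμ hμ1, dn_of_sn_eq_zero (sn_zero hμ hμ1)] at h2
  have hb0 : b ^ 2 ≠ 0 := by positivity
  have h3 : (μ * 1 + 1) ^ 2 = (μ * cn u μ + dn u μ) ^ 2 :=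
    mul_left_cancel₀ hb0 (by linarith)
  have hc1 : cn u μ ≤ 1 := Real.cos_le_one _
  have hc2 : -1 ≤ cn u μ := Real.neg_one_le_cos _
  have hd0 := dn_pos hμ.le hμ1 u
  have hd1 : dn u μ ≤ 1 := Real.sqrt_le_one.2 (by nlinarith [sq_nonneg (μ * sn u μ)])
  rcases sq_eq_sq_iff_eq_or_eq_neg.1 h3 with h4 | h4 <;> nlinarith

lemma hasPeriod_cmcHelicoid_iff {H : ℝ} (hH : H ≠ 0) (hμ : 0 < μ) (hb : 1 < b)
    (hμb : μ * b < 1) :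
    HasPeriod (cmcHelicoid H μ b) ↔ ∃ q : ℚ, Φ μ b = (q : ℝ) := by
  have hμ1 := modulus_lt_one hμ hb hμb
  rw [cmcHelicoid_eq_screwSurface]
  refine ⟨phi_rational_of_hasPeriod (by simpa using hH) hμ hb hμb ?_ ?_,
    hasPeriod_of_phi_rational _ hμ hb hμb (profileC_add_two_periods hμ hμ1) ?_⟩
  · rw [profileC_of_sn_eq_zero (sn_zero hμ hμ1), cn_zero hμ hμ1]
    norm_cast
    positivity
  · intro u hu
    have hc := cn_eq_one_of_norm_profileC_eq hμ hb hμb hu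
    have hs : sn u μ = 0 := by
      have := sn_sq_add_cn_sq (k := μ) u
      rw [hc] at this
      exact pow_eq_zero_iff two_ne_zero |>.1 (by linarith)
    refine ⟨hs, by simp [hs], Or.inl ?_⟩
    rw [profileC_of_sn_eq_zero hs, profileC_of_sn_eq_zero (sn_zero hμ hμ1), hc, cn_zero hμ hμ1]
  · intro u j
    rw [sn_add_two_periods hμ.le hμ1]

lemma hasPeriod_cgcCompanion_iff {H : ℝ} (hH : H ≠ 0) (hμ : 0 < μ) (hb : 1 < b)
    (hμb : μ * b < 1) :
    HasPeriod (cgcCompanion H (cmcHelicoid H μ b)) ↔ ∃ q : ℚ, Φ μ b = (q : ℝ) := by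
  have hμ1 := modulus_lt_one hμ hb hμb
  have hs0 := sn_zero hμ hμ1
  rw [cgcCompanion_eq_screwSurface hH hμ hb hμb]
  refine ⟨phi_rational_of_hasPeriod (by simpa using hH) hμ hb hμb ?_ ?_,
    hasPeriod_of_phi_rational _ hμ hb hμb (fun u j => ?_) fun _ _ => rfl⟩
  · rw [profileC_of_sn_eq_zero hs0, rad_of_sn_eq_zero hs0, cn_zero hμ hμ1]
    have : μ * b ^ 2 ≠ 0 := by positivity
    simpa using this
  · intro u hu
    have h2 := norm_companion_sq hμ hb hμb u
    rw [hu, norm_companion_sq hμ hb hμb, hs0] at h2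
    have hμb0 : μ ^ 2 * b ^ 2 ≠ 0 := by positivity
    have h3 := mul_left_cancel₀ hμb0 h2
    have hs : sn u μ = 0 := pow_eq_zero_iff two_ne_zero |>.1 (by linarith)
    refine ⟨hs, rfl, ?_⟩
    have hc := sn_sq_add_cn_sq (k := μ) u
    rw [hs, zero_pow two_ne_zero, zero_add] at hc
    simp only [profileC_of_sn_eq_zero hs, profileC_of_sn_eq_zero hs0, rad_of_sn_eq_zero hs,
      rad_of_sn_eq_zero hs0, cn_zero hμ hμ1]
    -- At a zero of `sn` the companion has `C = μ b² cn` with `cn = ±1`, so both signs remain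
    -- possible.
    rcases eq_or_eq_neg_of_sq_eq_sq _ 1 (hc.trans (one_pow 2).symm) with hc | hc <;> simp [hc]
  · rw [profileC_add_two_periods hμ hμ1, rad_add_two_periods hμ hμ1]

end Parameters

end CmcHelicoid

end

theorem proposition6p7 (H μ b : ℝ) (hH : H ≠ 0) (hμ : 0 < μ) (hb : 1 < b) (hμb : b < 1 / μ) :
    (CmcHelicoid.HasPeriod (CmcHelicoid.cgcCompanion H (CmcHelicoid.cmcHelicoid H μ b)) ↔
        ∃ q : ℚ, CmcHelicoid.Φ μ b = (q : ℝ)) ∧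
      (CmcHelicoid.HasPeriod (CmcHelicoid.cmcHelicoid H μ b) ↔
        ∃ q : ℚ, CmcHelicoid.Φ μ b = (q : ℝ)) := by
  have h : μ * b < 1 := by rwa [lt_div_iff₀' hμ] at hμb
  exact ⟨CmcHelicoid.hasPeriod_cgcCompanion_iff hH hμ hb h,
    CmcHelicoid.hasPeriod_cmcHelicoid_iff hH hμ hb h⟩
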